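/- \textbf{Conventions.} Let $X\subseteq\mathbb{R}$ carry the subspace topology. ``Countable'' means finite or countably infinite. For families $\mathcal A,\mathcal B$ of subsets of a set: $S_1(\mathcal A,\mathcal B)$ says that for every sequence $(A_n)_{n\in\mathbb N}$ of elements of $\mathcal A$ there are $b_n\in A_n$ with $\{b_n:n\in\mathbb N\}\in\mathcal B$; $S_{fin}(\mathcal A,\mathcal B)$ says that for every such sequence there are finite sets $B_n\subseteq A_n$ with $\bigcup_{n}B_n\in\mathcal B$. A family $\mathcal U$ of subsets of $X$ is a $\gamma$-cover of $X$ if $\mathcal U$ is infinite and each $x\in X$ belongs to all but finitely many elements of $\mathcal U$. Let $B_\Gamma$ (respectively $F_\Gamma$) be the set of all countable $\gamma$-covers of $X$ by Borel (respectively closed) subsets of $X$. A subset $D$ of a topological space $Z$ is sequentially dense if every point of $Z$ is the limit of a sequence of elements of $D$; $\mathcal S$ is the family of all countable sequentially dense subsets of $Z$, and $Z$ is sequentially separable if $\mathcal S\neq\emptyset$. We say that $Z$ satisfies $S_1(\mathcal S,\mathcal S)$ or $S_{fin}(\mathcal S,\mathcal S)$ if this holds for the family $\mathcal S$ of $Z$.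 Let $B(X)$ be the set of all Borel functions $X\to\mathbb R$, and $B_1(X)$ the set of all functions $X\to\mathbb R$ that are pointwise limits of sequences of continuous functions $X\to\mathbb R$, both with the topology of pointwise convergence. \textbf{Theorem.} For every set of reals $X\subseteq\mathbb R$, the following statements are equivalent: \begin{enumerate} \item $B(X)$ satisfies $S_1(\mathcal S,\mathcal S)$ and $B(X)$ is sequentially separable; \item $X$ satisfies $S_1(B_\Gamma,B_\Gamma)$; \item $B(X)$ satisfies $S_{fin}(\mathcal S,\mathcal S)$ and $B(X)$ is sequentially separable; \item $X$ satisfies $S_{fin}(B_\Gamma,B_\Gamma)$; \item $B_1(X)$ satisfies $S_1(\mathcal S,\mathcal S)$; \item $X$ satisfies $S_1(F_\Gamma,F_\Gamma)$; \item $B_1(X)$ satisfies $S_{fin}(\mathcal S,\mathcal S)$. \end{enumerate} -/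

import Mathlib

open Set Filter Topology

namespace BorelSelection

/-- The selection principle `S₁(𝒜, ℬ)` for families `𝒜`, `ℬ` of subsets of `α`. -/
def S₁ {α : Type*} (𝒜 ℬ : Set (Set α)) : Prop :=
  ∀ A : ℕ → Set α, (∀ n, A n ∈ 𝒜) →
    ∃ b : ℕ → α, (∀ n, b n ∈ A n) ∧ range b ∈ ℬ

/-- The selection principle `S_fin(𝒜, ℬ)` for families `𝒜`, `ℬ` of subsets of `α`. -/
def SFin {α : Type*} (𝒜 ℬ : Set (Set α)) : Prop :=
  ∀ A : ℕ → Set α, (∀ n, A n ∈ 𝒜) →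
    ∃ B : ℕ → Set α, (∀ n, (B n).Finite ∧ B n ⊆ A n) ∧ (⋃ n, B n) ∈ ℬ

/-- A `γ`-cover of `X`: an infinite family of subsets such that every point of `X` belongs to
all but finitely many members. -/
def IsGammaCover {X : Type*} (𝒰 : Set (Set X)) : Prop :=
  𝒰.Infinite ∧ ∀ x : X, {U ∈ 𝒰 | x ∉ U}.Finite

/-- The family of all countable Borel `γ`-covers of `X`. -/
def BorelGamma (X : Type*) [MeasurableSpace X] [TopologicalSpace X] [BorelSpace X] :
    Set (Set (Set X)) :=
  {𝒰 | 𝒰.Countable ∧ (∀ U ∈ 𝒰, MeasurableSet U) ∧ IsGammaCover 𝒰}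

/-- The family of all countable closed `γ`-covers of `X`. -/
def ClosedGamma (X : Type*) [TopologicalSpace X] : Set (Set (Set X)) :=
  {𝒰 | 𝒰.Countable ∧ (∀ U ∈ 𝒰, IsClosed U) ∧ IsGammaCover 𝒰}

/-- A set is sequentially dense if every point is the limit of a sequence from the set. -/
def SeqDense {Z : Type*} [TopologicalSpace Z] (D : Set Z) : Prop :=
  seqClosure D = univ

/-- The family `𝒮` of all countable sequentially dense subsets of `Z`. -/
def CountableSeqDense (Z : Type*) [TopologicalSpace Z] : Set (Set Z) :=
  {D | D.Countable ∧ SeqDense D}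

/-- `Z` is sequentially separable: it has a countable sequentially dense subset. -/
def SeqSeparable (Z : Type*) [TopologicalSpace Z] : Prop :=
  ∃ D : Set Z, D.Countable ∧ SeqDense D

/-- The space `B(X)` of real-valued Borel functions on `X`. As a subtype of `X → ℝ` it carries
the topology of pointwise convergence. -/
abbrev BorelFun (X : Type*) [MeasurableSpace X] [TopologicalSpace X] [BorelSpace X] : Type _ :=
  {f : X → ℝ // Measurable f}

/-- The space `B₁(X)` of functions of the first Baire class, i.e. pointwise limits of sequences of
continuous real-valued functions, with the topology of pointwise convergence. -/
abbrev BaireOneFun (X : Type*) [TopologicalSpace X] : Type _ :=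
  {f : X → ℝ // ∃ g : ℕ → X → ℝ, (∀ n, Continuous (g n)) ∧
    ∀ x, Tendsto (fun n => g n x) atTop (𝓝 (f x))}

end BorelSelection

/-!
Every principle in the list is compared with one principle for sequences of sets: from countably
many sequences of closed sets, each containing every point eventually, one can select one set from
each so that every point is eventually in the selected sets. If this holds, every `Gδ` set is `Fσ`:
write it as the intersection of decreasing open sets, each an increasing union of closed sets, and
select one closed set from each union. Hence every Borel set is `Fσ`, every Borel `γ`-cover can be
shrunk to closed sets, and Borel functions pull open sets back to `Fσ` sets. The last property is
all that is needed to approximate a function pointwise by rational-valued functions depending on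
finitely many sets of a countable base, which gives sequential separability.

Function spaces are related to covers as follows. Approximating a function within `1 / (n + 1)`
defines sets of points that select good approximants. Conversely, cutting the members of a countable
sequentially dense set off outside the sets of a `γ`-sequence yields a sequentially dense set, and a
sequence of cut-off functions converging to a nonzero constant eventually has every point in its
cut-off sets.
-/

namespace BorelSelection

section GammaSeq

variable {X : Type*}

/-- A `γ`-sequence: the indexed analogue of a `γ`-cover. Repetitions, and the whole space as a
member, are allowed, so that no infinity condition has to be maintained. -/
def IsGammaSeq (U : ℕ → Set X) : Prop :=
  ∀ x, ∀ᶠ n in atTop, x ∈ U n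

theorem IsGammaSeq.mono {U V : ℕ → Set X} (hU : IsGammaSeq U) (hUV : ∀ n, U n ⊆ V n) :
    IsGammaSeq V :=
  fun x => (hU x).mono fun n hn => hUV n hn

theorem IsGammaSeq.comp_tendsto {U : ℕ → Set X} (hU : IsGammaSeq U) {φ : ℕ → ℕ}
    (hφ : Tendsto φ atTop atTop) : IsGammaSeq fun n => U (φ n) :=
  fun x => hφ.eventually (hU x)

theorem isGammaSeq_dissipate {W : ℕ → ℕ → Set X} (hW : ∀ j, IsGammaSeq (W j)) (n : ℕ) :
    IsGammaSeq fun k => dissipate (fun j => W j k) n := by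
  intro x
  simp only [mem_dissipate]
  exact (eventually_all_finite (finite_Iic n)).2 fun j _ => hW j x

theorem IsGammaSeq.infinite_range {U : ℕ → Set X} (hU : IsGammaSeq U) (hne : ∀ k, U k ≠ univ) :
    (range U).Infinite := by
  intro hfin
  have hev : ∀ᶠ k in atTop, ∀ V ∈ range U, U k ≠ V := by
    rw [eventually_all_finite hfin]
    rintro _ ⟨j, rfl⟩
    obtain ⟨x, hx⟩ := (ne_univ_iff_exists_notMem _).1 (hne j)
    filter_upwards [hU x] with k hk hkj
    exact hx (hkj ▸ hk)
  obtain ⟨k, hk⟩ := hev.exists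
  exact hk _ (mem_range_self k) rfl

theorem IsGammaSeq.isGammaCover_range {U : ℕ → Set X} (hU : IsGammaSeq U)
    (hinf : (range U).Infinite) : IsGammaCover (range U) := by
  refine ⟨hinf, fun x => ?_⟩
  have hfin : {k | x ∉ U k}.Finite := by
    rw [← eventually_cofinite, Nat.cofinite_eq_atTop]
    exact hU x
  refine (hfin.image U).subset ?_
  rintro _ ⟨⟨k, rfl⟩, hk⟩
  exact mem_image_of_mem U hk

theorem IsGammaCover.exists_injective_isGammaSeq {𝒰 : Set (Set X)} (h : IsGammaCover 𝒰) :
    ∃ u : ℕ → Set X, Function.Injective u ∧ (∀ k, u k ∈ 𝒰) ∧ IsGammaSeq u := by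
  let u : ℕ → Set X := fun k => h.1.natEmbedding _ k
  have hu : Function.Injective u := Subtype.val_injective.comp (Function.Embedding.injective _)
  have hmem : ∀ k, u k ∈ 𝒰 := fun k => Subtype.prop _
  refine ⟨u, hu, hmem, fun x => ?_⟩
  rw [← Nat.cofinite_eq_atTop, eventually_cofinite]
  exact ((h.2 x).preimage hu.injOn).subset fun k hk => ⟨hmem k, hk⟩

end GammaSeq

section Selection

theorem S₁.sFin {α : Type*} {𝒜 ℬ : Set (Set α)} (h : S₁ 𝒜 ℬ) : SFin 𝒜 ℬ := by
  intro A hA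
  obtain ⟨b, hb, hrange⟩ := h A hA
  refine ⟨fun n => {b n}, fun n => ⟨finite_singleton _, singleton_subset_iff.2 (hb n)⟩, ?_⟩
  simpa only [iUnion_singleton_eq_range] using hrange

theorem tendsto_atTop_of_mem_finite {α : Type*} {B : ℕ → Set α} (hB : ∀ n, (B n).Finite)
    {b : ℕ → α} {ν : ℕ → ℕ} (hb : ∀ i, b i ∈ B (ν i))
    (hne : ∀ n, ∀ a ∈ B n, ∀ᶠ i in atTop, b i ≠ a) : Tendsto ν atTop atTop := by
  refine tendsto_atTop.2 fun N => ?_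
  have hev : ∀ᶠ i in atTop, ∀ n ∈ Iio N, ∀ a ∈ B n, b i ≠ a :=
    (eventually_all_finite (finite_Iio N)).2 fun n _ =>
      (eventually_all_finite (hB n)).2 (hne n)
  filter_upwards [hev] with i hi
  by_contra! hlt
  exact hi (ν i) hlt (b i) (hb i) rfl

theorem exists_injective_mem_of_lt_card {α : Type*} (t : ℕ → Finset α)
    (ht : ∀ n, n < (t n).card) : ∃ f : ℕ → α, Function.Injective f ∧ ∀ n, f n ∈ t n := by
  classical
  rw [← Finset.all_card_le_biUnion_card_iff_exists_injective]
  intro s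
  rcases s.eq_empty_or_nonempty with rfl | hs
  · simp
  have hsub : s ⊆ Finset.range (s.max' hs + 1) := fun n hn =>
    Finset.mem_range.2 (Nat.lt_succ_of_le (s.le_max' n hn))
  calc s.card ≤ s.max' hs + 1 := by simpa using Finset.card_le_card hsub
    _ ≤ (t (s.max' hs)).card := ht _
    _ ≤ (s.biUnion t).card :=
      Finset.card_le_card (Finset.subset_biUnion_of_mem t (s.max'_mem hs))

variable {X : Type*} {𝒞 : Set (Set X)}

/-- The countable `γ`-covers with members in `𝒞`; this specializes to `BorelGamma` and
`ClosedGamma`. -/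
def GammaCovers (𝒞 : Set (Set X)) : Set (Set (Set X)) :=
  {𝒰 | 𝒰.Countable ∧ (∀ U ∈ 𝒰, U ∈ 𝒞) ∧ IsGammaCover 𝒰}

/-- The selection principle for `γ`-sequences in `𝒞`: from countably many of them one can select
one member each so that the selected sets again form a `γ`-sequence. All the principles of the
theorem are compared with this one. -/
def SelectsGammaSeq (𝒞 : Set (Set X)) : Prop :=
  ∀ W : ℕ → ℕ → Set X, (∀ n k, W n k ∈ 𝒞) → (∀ n, IsGammaSeq (W n)) →
    ∃ k : ℕ → ℕ, IsGammaSeq fun n => W n (k n)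

theorem SelectsGammaSeq.mono {𝒟 : Set (Set X)} (h : SelectsGammaSeq 𝒟) (h𝒞 : 𝒞 ⊆ 𝒟) :
    SelectsGammaSeq 𝒞 :=
  fun W hW => h W fun n k => h𝒞 (hW n k)

theorem dissipate_mem_of_finiteInter (h𝒞 : FiniteInter 𝒞) {W : ℕ → Set X} (hW : ∀ n, W n ∈ 𝒞)
    (n : ℕ) : dissipate W n ∈ 𝒞 := by
  induction n with
  | zero => simpa only [dissipate_zero_nat] using hW 0
  | succ n ih => simpa only [dissipate_succ] using h𝒞.inter_mem ih (hW (n + 1))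

theorem selectsGammaSeq_of_antitone (h𝒞 : FiniteInter 𝒞)
    (h : ∀ V : ℕ → ℕ → Set X, (∀ n k, V n k ∈ 𝒞) → (∀ n, IsGammaSeq (V n)) →
      (∀ k, Antitone fun n => V n k) → ∃ k : ℕ → ℕ, IsGammaSeq fun n => V n (k n)) :
    SelectsGammaSeq 𝒞 := by
  intro W hW hγ
  obtain ⟨k, hk⟩ := h (fun n k => dissipate (fun j => W j k) n)
    (fun n k => dissipate_mem_of_finiteInter h𝒞 (fun j => hW j k) n)
    (isGammaSeq_dissipate hγ) fun k => antitone_dissipate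
  exact ⟨k, hk.mono fun n => dissipate_subset le_rfl⟩

theorem exists_isGammaSeq_of_tendsto {V : ℕ → ℕ → Set X} (hV : ∀ k, Antitone fun n => V n k)
    {ν κ : ℕ → ℕ} (hν : Tendsto ν atTop atTop) (h : IsGammaSeq fun i => V (ν i) (κ i)) :
    ∃ k : ℕ → ℕ, IsGammaSeq fun n => V n (k n) := by
  have hex : ∀ n, ∃ i, n ≤ i ∧ n ≤ ν i := fun n =>
    ((eventually_ge_atTop n).and (hν.eventually_ge_atTop n)).exists
  choose i hi hνi using hex
  have hit : Tendsto i atTop atTop := tendsto_atTop_mono hi tendsto_id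
  exact ⟨fun n => κ (i n), (h.comp_tendsto hit).mono fun n => hV _ (hνi n)⟩

theorem range_mem_gammaCovers {U : ℕ → Set X} (hU : ∀ k, U k ∈ 𝒞) (hγ : IsGammaSeq U)
    (hinf : (range U).Infinite) : range U ∈ GammaCovers 𝒞 :=
  ⟨countable_range U, forall_mem_range.2 hU, hγ.isGammaCover_range hinf⟩

theorem SelectsGammaSeq.of_sFin (h𝒞 : FiniteInter 𝒞)
    (h : SFin (GammaCovers 𝒞) (GammaCovers 𝒞)) : SelectsGammaSeq 𝒞 := by
  refine selectsGammaSeq_of_antitone h𝒞 fun V hV hγ hanti => ?_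
  by_cases hall : ∀ n, ∃ k, V n k = univ
  · choose k hk using hall
    exact ⟨k, fun x => Eventually.of_forall fun n => eq_univ_iff_forall.1 (hk n) x⟩
  push Not at hall
  obtain ⟨N, hN⟩ := hall
  have hne : ∀ n k, V (N + n) k ≠ univ := fun n k huniv =>
    hN k (univ_subset_iff.1 (huniv ▸ hanti k (Nat.le_add_right N n)))
  obtain ⟨B, hB, -, -, hcover⟩ := h (fun n => range (V (N + n))) fun n =>
    range_mem_gammaCovers (hV _) (hγ _) ((hγ _).infinite_range (hne n))
  obtain ⟨u, hu, hmem, huγ⟩ := hcover.exists_injective_isGammaSeq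
  choose ν hν using fun i => mem_iUnion.1 (hmem i)
  choose κ hκ using fun i => (hB (ν i)).2 (hν i)
  have hνtop : Tendsto ν atTop atTop :=
    tendsto_atTop_of_mem_finite (fun n => (hB n).1) hν fun n U _ =>
      Nat.cofinite_eq_atTop ▸ hu.tendsto_cofinite.eventually (eventually_cofinite_ne U)
  exact exists_isGammaSeq_of_tendsto hanti (ν := fun i => N + ν i) (κ := κ)
    (tendsto_atTop_mono (fun i => Nat.le_add_left _ _) hνtop) (by simpa only [hκ] using huγ)

-- The selected sets must be pairwise distinct. So from the `n`-th cover a block of `n + 1`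
-- consecutive members is selected, and Hall's theorem picks distinct members from these blocks.
theorem SelectsGammaSeq.s₁ (h𝒞 : FiniteInter 𝒞) (h : SelectsGammaSeq 𝒞) :
    S₁ (GammaCovers 𝒞) (GammaCovers 𝒞) := by
  classical
  intro A hA
  choose u hinj hmem hγ using fun n => (hA n).2.2.exists_injective_isGammaSeq
  obtain ⟨k, hk⟩ := h (fun n k => dissipate (fun j => u n (k + j)) n)
    (fun n k => dissipate_mem_of_finiteInter h𝒞 (fun j => (hA n).2.1 _ (hmem n (k + j))) n)
    (fun n => isGammaSeq_dissipate (fun j => (hγ n).comp_tendsto (tendsto_add_atTop_nat j)) n)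
  obtain ⟨b, hbinj, hb⟩ := exists_injective_mem_of_lt_card
    (fun n => (Finset.range (n + 1)).image fun j => u n (k n + j)) fun n => by
      have hj : Function.Injective fun j => u n (k n + j) :=
        (hinj n).comp (add_right_injective _)
      simp [Finset.card_image_of_injective _ hj]
  choose j hj hjb using fun n => Finset.mem_image.1 (hb n)
  have hbA : ∀ n, b n ∈ A n := fun n => hjb n ▸ hmem n _
  refine ⟨b, hbA, range_mem_gammaCovers (fun n => (hA n).2.1 _ (hbA n))
    (hk.mono fun n => ?_) (infinite_range_of_injective hbinj)⟩
  exact (dissipate_subset (Finset.mem_range_succ_iff.1 (hj n))).trans (hjb n).subset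

end Selection

section Borel

variable {X : Type*} [TopologicalSpace X]

/-- An `Fσ` set, i.e. a countable union of closed sets, encoded as the complement of a `Gδ` set
so that the library results on `Gδ` sets apply. -/
def IsFσ (s : Set X) : Prop :=
  IsGδ sᶜ

theorem isFσ_of_isClosed {s : Set X} (hs : IsClosed s) : IsFσ s :=
  hs.isOpen_compl.isGδ

theorem isFσ_of_isOpen [PerfectlyNormalSpace X] {s : Set X} (hs : IsOpen s) : IsFσ s :=
  hs.isClosed_compl.isGδ

theorem IsFσ.iUnion {ι : Type*} [Countable ι] {s : ι → Set X} (hs : ∀ i, IsFσ (s i)) :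
    IsFσ (⋃ i, s i) := by
  rw [IsFσ, compl_iUnion]
  exact IsGδ.iInter hs

theorem IsFσ.exists_monotone_isClosed {s : Set X} (hs : IsFσ s) :
    ∃ F : ℕ → Set X, (∀ n, IsClosed (F n)) ∧ Monotone F ∧ ⋃ n, F n = s := by
  obtain ⟨U, hU, hUs⟩ := isGδ_iff_eq_iInter_nat.1 hs
  refine ⟨accumulate fun n => (U n)ᶜ, fun n => ?_, monotone_accumulate, ?_⟩
  · exact (finite_Iic n).isClosed_biUnion fun i _ => (hU i).isClosed_compl
  · rw [iUnion_accumulate, ← compl_iInter, ← hUs, compl_compl]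

theorem isFσ_setOf_eventually_mem {F : ℕ → Set X} (hF : ∀ n, IsClosed (F n)) :
    IsFσ {x | ∀ᶠ n in atTop, x ∈ F n} := by
  have heq : {x | ∀ᶠ n in atTop, x ∈ F n} = ⋃ N : ℕ, ⋂ n ∈ Ici N, F n := by
    ext x
    simp [eventually_atTop]
  rw [heq]
  exact IsFσ.iUnion fun N => isFσ_of_isClosed (isClosed_biInter fun n _ => hF n)

theorem finiteInter_isClosed : FiniteInter {s : Set X | IsClosed s} :=
  ⟨isClosed_univ, fun _ hs _ ht => IsClosed.inter hs ht⟩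

theorem finiteInter_measurableSet {X : Type*} [MeasurableSpace X] :
    FiniteInter {s : Set X | MeasurableSet s} :=
  ⟨MeasurableSet.univ, fun _ hs _ ht => MeasurableSet.inter hs ht⟩

theorem SelectsGammaSeq.isFσ_of_isGδ [PerfectlyNormalSpace X]
    (h : SelectsGammaSeq {s : Set X | IsClosed s}) {s : Set X} (hs : IsGδ s) : IsFσ s := by
  obtain ⟨U, hU, rfl⟩ := isGδ_iff_eq_iInter_nat.1 hs
  have hT : ∀ n, IsOpen (dissipate U n) := fun n =>
    (finite_Iic n).isOpen_biInter fun j _ => hU j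
  choose F hF hmono hFT using fun n => (isFσ_of_isOpen (hT n)).exists_monotone_isClosed
  obtain ⟨k, hk⟩ := h (fun n k => F n k ∪ (dissipate U n)ᶜ)
    (fun n k => (hF n k).union (hT n).isClosed_compl) fun n x => by
      by_cases hx : x ∈ dissipate U n
      · rw [← hFT n] at hx
        obtain ⟨j, hj⟩ := mem_iUnion.1 hx
        filter_upwards [eventually_ge_atTop j] with i hi
        exact Or.inl (hmono n hi hj)
      · exact Eventually.of_forall fun i => Or.inr hx
  have heq : ⋂ n, U n = {x | ∀ᶠ n in atTop, x ∈ F n (k n)} := by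
    ext x
    refine ⟨fun hx => ?_, fun hx => mem_iInter.2 fun j => ?_⟩
    · filter_upwards [hk x] with n hn
      exact hn.resolve_right (not_not_intro (iInter_subset_dissipate n hx))
    · obtain ⟨n, hn, hjn⟩ := (Eventually.and hx (eventually_ge_atTop j)).exists
      exact dissipate_subset hjn (hFT n ▸ mem_iUnion_of_mem (k n) hn)
  rw [heq]
  exact isFσ_setOf_eventually_mem fun n => hF n (k n)

theorem SelectsGammaSeq.isFσ_of_measurableSet [PerfectlyNormalSpace X] [MeasurableSpace X]
    [BorelSpace X] (h : SelectsGammaSeq {s : Set X | IsClosed s}) {s : Set X}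
    (hs : MeasurableSet s) : IsFσ s := by
  induction s, hs using MeasurableSet.induction_on_open with
  | isOpen U hU => exact isFσ_of_isOpen hU
  | compl t _ ih => exact h.isFσ_of_isGδ ih
  | iUnion f _ _ ih => exact IsFσ.iUnion ih

theorem IsGammaSeq.exists_isClosed_subset {W : ℕ → Set X} (hW : IsGammaSeq W)
    (hFσ : ∀ k, IsFσ (⋂ j ∈ Ici k, W j)) :
    ∃ V : ℕ → Set X, (∀ j, IsClosed (V j)) ∧ IsGammaSeq V ∧ ∀ j, V j ⊆ W j := by
  choose F hF hmono hFW using fun k => (hFσ k).exists_monotone_isClosed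
  refine ⟨fun j => ⋃ k ∈ Iic j, F k j,
    fun j => (finite_Iic j).isClosed_biUnion fun k _ => hF k j, fun x => ?_,
    fun j => iUnion₂_subset fun k hk => ?_⟩
  · obtain ⟨k, hk⟩ := eventually_atTop.1 (hW x)
    have hx : x ∈ ⋃ j, F k j := by
      rw [hFW]
      exact mem_iInter₂.2 hk
    obtain ⟨i, hi⟩ := mem_iUnion.1 hx
    filter_upwards [eventually_ge_atTop i, eventually_ge_atTop k] with j hij hkj
    exact mem_biUnion (mem_Iic.2 hkj) (hmono k hij hi)
  · calc F k j ⊆ ⋂ i ∈ Ici k, W i := hFW k ▸ subset_iUnion (F k) j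
      _ ⊆ W j := biInter_subset_of_mem hk

theorem selectsGammaSeq_measurableSet_iff_isClosed [PerfectlyNormalSpace X] [MeasurableSpace X]
    [BorelSpace X] :
    SelectsGammaSeq {s : Set X | MeasurableSet s} ↔ SelectsGammaSeq {s : Set X | IsClosed s} := by
  refine ⟨fun h => h.mono fun s hs => IsClosed.measurableSet hs, fun h W hW hγ => ?_⟩
  choose V hV hVγ hVW using fun n => (hγ n).exists_isClosed_subset fun k =>
    h.isFσ_of_measurableSet (MeasurableSet.biInter (to_countable _) fun j _ => hW n j)
  obtain ⟨k, hk⟩ := h V hV hVγ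
  exact ⟨k, hk.mono fun n => hVW n (k n)⟩

end Borel

section BaireOne

variable {X : Type*} [TopologicalSpace X]

/-- A function of the first Baire class: a pointwise limit of continuous functions. It is the
predicate that cuts out `BaireOneFun X`. -/
def IsBaireOne (f : X → ℝ) : Prop :=
  ∃ g : ℕ → X → ℝ, (∀ n, Continuous (g n)) ∧ ∀ x, Tendsto (fun n => g n x) atTop (𝓝 (f x))

theorem isBaireOne_const (c : ℝ) : IsBaireOne fun _ : X => c :=
  ⟨fun _ _ => c, fun _ => continuous_const, fun _ => tendsto_const_nhds⟩

theorem IsBaireOne.continuous_comp {ι : Type*} {f : ι → X → ℝ} (hf : ∀ i, IsBaireOne (f i))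
    {G : (ι → ℝ) → ℝ} (hG : Continuous G) : IsBaireOne fun x => G fun i => f i x := by
  choose g hg hlim using hf
  exact ⟨fun n x => G fun i => g i n x, fun n => hG.comp (continuous_pi fun i => hg i n),
    fun x => (hG.tendsto _).comp (tendsto_pi_nhds.2 fun i => hlim i x)⟩

theorem IsBaireOne.mul {f g : X → ℝ} (hf : IsBaireOne f) (hg : IsBaireOne g) :
    IsBaireOne fun x => f x * g x := by
  obtain ⟨u, hu, hul⟩ := hf
  obtain ⟨v, hv, hvl⟩ := hg
  exact ⟨fun n x => u n x * v n x, fun n => (hu n).mul (hv n), fun x => (hul x).mul (hvl x)⟩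

theorem isBaireOne_indicator_one [HasOuterApproxClosed X] {F : Set X} (hF : IsClosed F) :
    IsBaireOne (F.indicator fun _ => 1) := by
  refine ⟨fun n x => hF.apprSeq n x, fun n => by fun_prop, fun x => ?_⟩
  have hcoe : F.indicator (fun _ => (1 : ℝ)) x = (F.indicator (fun _ => (1 : NNReal)) x : NNReal) :=
    by by_cases hx : x ∈ F <;> simp [hx]
  rw [hcoe]
  exact (NNReal.continuous_coe.tendsto _).comp
    (tendsto_pi_nhds.1 (HasOuterApproxClosed.tendsto_apprSeq hF) x)

theorem IsBaireOne.indicator [HasOuterApproxClosed X] {f : X → ℝ} (hf : IsBaireOne f) {F : Set X}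
    (hF : IsClosed F) : IsBaireOne (F.indicator f) := by
  convert (isBaireOne_indicator_one hF).mul hf using 2 with x
  by_cases hx : x ∈ F <;> simp [hx]

theorem IsBaireOne.measurable [MeasurableSpace X] [BorelSpace X] {f : X → ℝ}
    (hf : IsBaireOne f) : Measurable f := by
  obtain ⟨g, hg, hlim⟩ := hf
  exact measurable_of_tendsto_metrizable (fun n => (hg n).measurable) (tendsto_pi_nhds.2 hlim)

theorem IsBaireOne.isFσ_preimage {f : X → ℝ} (hf : IsBaireOne f) {U : Set ℝ} (hU : IsOpen U) :
    IsFσ (f ⁻¹' U) := by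
  obtain ⟨g, hg, hlim⟩ := hf
  let 𝒱 : Set (Set ℝ) := {V ∈ TopologicalSpace.countableBasis ℝ | closure V ⊆ U}
  have hcount : Countable 𝒱 :=
    ((TopologicalSpace.countable_countableBasis ℝ).mono (sep_subset _ _)).to_subtype
  have hbasis := TopologicalSpace.isBasis_countableBasis ℝ
  have heq : f ⁻¹' U = ⋃ V : 𝒱, {x | ∀ᶠ n in atTop, x ∈ g n ⁻¹' closure V} := by
    ext x
    refine ⟨fun hx => ?_, fun hx => ?_⟩
    · obtain ⟨V, hV, hxV, hVU⟩ := hbasis.exists_closure_subset (hU.mem_nhds hx)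
      have hev : ∀ᶠ n in atTop, g n x ∈ V :=
        (hlim x).eventually_mem ((hbasis.isOpen hV).mem_nhds hxV)
      exact mem_iUnion.2 ⟨⟨V, hV, hVU⟩, hev.mono fun n hn => subset_closure hn⟩
    · obtain ⟨V, hV⟩ := mem_iUnion.1 hx
      exact V.2.2 (isClosed_closure.mem_of_tendsto (hlim x) hV)
  rw [heq]
  exact IsFσ.iUnion fun V =>
    isFσ_setOf_eventually_mem fun n => isClosed_closure.preimage (hg n)

end BaireOne

section Pattern

variable {X : Type*}

open Classical in
/-- The membership pattern of `x` in a family of sets. Rational-valued functions of the patterns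
in the initial segments of a countable base form the countable sequentially dense set. -/
noncomputable def pattern {ι : Type*} (O : ι → Set X) (x : X) : ι → Bool :=
  fun i => decide (x ∈ O i)

theorem exists_rat_forall_dist_lt (c r : ℕ → ℝ) (T : Set ℕ) (n : ℕ) :
    ∃ q : ℚ, ∀ k ≤ n, (∃ y : ℝ, ∀ s < k, s ∈ T → dist y (c s) < r s) →
      ∀ s < k, s ∈ T → dist (q : ℝ) (c s) < r s := by
  classical
  let P : ℕ → Prop := fun k => ∃ y : ℝ, ∀ s < k, s ∈ T → dist y (c s) < r s
  obtain ⟨y, hy⟩ : P (Nat.findGreatest P n) :=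
    Nat.findGreatest_spec (Nat.zero_le n) ⟨0, fun s hs => absurd hs (Nat.not_lt_zero s)⟩
  have hopen : IsOpen (⋂ s ∈ Iio (Nat.findGreatest P n) ∩ T, Metric.ball (c s) (r s)) :=
    ((finite_Iio _).inter_of_left T).isOpen_biInter fun s _ => Metric.isOpen_ball
  obtain ⟨q, hq⟩ := Rat.denseRange_cast.exists_mem_open hopen
    ⟨y, mem_iInter₂.2 fun s hs => hy s hs.1 hs.2⟩
  exact ⟨q, fun k hkn hk s hs hsT =>
    mem_iInter₂.1 hq s ⟨hs.trans_le (Nat.le_findGreatest hkn hk), hsT⟩⟩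

variable [TopologicalSpace X]

theorem isBaireOne_comp_pattern [HasOuterApproxClosed X] {ι : Type*} [Finite ι] {O : ι → Set X}
    (hO : ∀ i, IsOpen (O i)) (G : (ι → Bool) → ℝ) : IsBaireOne fun x => G (pattern O x) := by
  let e : (ι → Bool) → ι → ℝ := fun a i => if a i then 0 else 1
  have he : IsClosedEmbedding e := continuous_of_discreteTopology.isClosedEmbedding fun a b hab =>
    funext fun i => by
      have hi := congrFun hab i
      cases ha : a i <;> cases hb : b i <;> simp_all [e]
  obtain ⟨g, hg⟩ := ContinuousMap.exists_extension he ⟨G, continuous_of_discreteTopology⟩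
  convert IsBaireOne.continuous_comp
    (fun i => isBaireOne_indicator_one (hO i).isClosed_compl) g.continuous using 2 with x
  have hx : e (pattern O x) = fun i => (O i)ᶜ.indicator (fun _ => (1 : ℝ)) x := by
    ext i
    by_cases hi : x ∈ O i <;> simp [e, pattern, hi]
  rw [← hx]
  exact (DFunLike.congr_fun hg (pattern O x)).symm

theorem eventually_forall_inter_nonempty_iff_mem {O : ℕ → Set X}
    (hO : TopologicalSpace.IsTopologicalBasis (range O)) {F : Set X} (hF : IsClosed F) (x : X) :
    ∀ᶠ n in atTop, (∀ i < n, x ∈ O i → (O i ∩ F).Nonempty) ↔ x ∈ F := by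
  by_cases hx : x ∈ F
  · exact Eventually.of_forall fun n => ⟨fun _ => hx, fun _ i _ hi => ⟨x, hi, hx⟩⟩
  obtain ⟨_, ⟨i, rfl⟩, hi, hiF⟩ := hO.exists_subset_of_mem_open (mem_compl hx) hF.isOpen_compl
  filter_upwards [eventually_gt_atTop i] with n hn
  refine ⟨fun hmeet => ?_, fun hxF => absurd hxF hx⟩
  obtain ⟨y, hyO, hyF⟩ := hmeet i hn hi
  exact absurd hyF (hiF hyO)

theorem exists_isClosed_cover_dist_lt {f : X → ℝ} (hf : ∀ U, IsOpen U → IsFσ (f ⁻¹' U)) :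
    ∃ (F : ℕ → Set X) (c r : ℕ → ℝ), (∀ s, IsClosed (F s)) ∧
      (∀ s, ∀ x ∈ F s, dist (f x) (c s) < r s) ∧ ∀ x, ∀ ε > 0, ∃ s, x ∈ F s ∧ r s < ε := by
  choose F hF _ hFf using fun (m : ℕ) (c : ℚ) =>
    (hf (Metric.ball c (1 / (m + 1))) Metric.isOpen_ball).exists_monotone_isClosed
  obtain ⟨e, he⟩ := exists_surjective_nat (ℕ × ℚ × ℕ)
  refine ⟨fun s => F (e s).1 (e s).2.1 (e s).2.2, fun s => (e s).2.1,
    fun s => 1 / ((e s).1 + 1), fun s => hF _ _ _,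
    fun s x hx => (hFf _ _).subset (mem_iUnion_of_mem _ hx), fun x ε hε => ?_⟩
  obtain ⟨m, hm⟩ := exists_nat_one_div_lt hε
  obtain ⟨c, hc⟩ := Rat.denseRange_cast.exists_dist_lt (f x) (Nat.one_div_pos_of_nat (n := m))
  obtain ⟨j, hj⟩ := mem_iUnion.1 ((hFf m c).symm.subset hc)
  obtain ⟨s, hs⟩ := he (m, c, j)
  exact ⟨s, by simpa only [hs] using hj, by simpa only [hs] using hm⟩

-- The value at a pattern respects as many of the constraints `dist · (c s) < r s` as possible,
-- among those indices `s` for which the pattern does not yet exclude membership in `F s`.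
theorem exists_tendsto_comp_pattern {O : ℕ → Set X}
    (hO : TopologicalSpace.IsTopologicalBasis (range O)) {f : X → ℝ}
    (hf : ∀ U, IsOpen U → IsFσ (f ⁻¹' U)) :
    ∃ G : ∀ n, (Fin n → Bool) → ℚ, ∀ x,
      Tendsto (fun n => (G n (pattern (fun i : Fin n => O i) x) : ℝ)) atTop (𝓝 (f x)) := by
  obtain ⟨F, c, r, hF, hFf, hsmall⟩ := exists_isClosed_cover_dist_lt hf
  choose G hG using fun n (a : Fin n → Bool) =>
    exists_rat_forall_dist_lt c r {s | ∀ i : Fin n, a i → (O i ∩ F s).Nonempty} n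
  refine ⟨G, fun x => Metric.tendsto_nhds.2 fun ε hε => ?_⟩
  obtain ⟨s₀, hs₀, hr⟩ := hsmall x (ε / 2) (half_pos hε)
  have hdecided : ∀ᶠ n in atTop, ∀ s ∈ Iic s₀,
      (∀ i < n, x ∈ O i → (O i ∩ F s).Nonempty) ↔ x ∈ F s :=
    (eventually_all_finite (finite_Iic s₀)).2 fun s _ =>
      eventually_forall_inter_nonempty_iff_mem hO (hF s) x
  filter_upwards [hdecided, eventually_gt_atTop s₀] with n hn hsn
  have hmem : ∀ s ≤ s₀, (s ∈ {s | ∀ i : Fin n, pattern (fun i : Fin n => O i) x i →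
      (O i ∩ F s).Nonempty}) ↔ x ∈ F s := fun s hs => by
    simpa [pattern, Fin.forall_iff] using hn s hs
  have hGs : dist (G n (pattern (fun i : Fin n => O i) x) : ℝ) (c s₀) < r s₀ :=
    hG n _ (s₀ + 1) hsn
      ⟨f x, fun s hs hsx => hFf s x ((hmem s (Nat.lt_succ_iff.1 hs)).1 hsx)⟩
      s₀ (Nat.lt_succ_self s₀) ((hmem s₀ le_rfl).2 hs₀)
  calc dist (G n (pattern (fun i : Fin n => O i) x) : ℝ) (f x)
      ≤ dist (G n (pattern (fun i : Fin n => O i) x) : ℝ) (c s₀) + dist (f x) (c s₀) :=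
        dist_triangle_right _ _ _
    _ < ε / 2 + ε / 2 := add_lt_add (hGs.trans hr) ((hFf s₀ x hs₀).trans hr)
    _ = ε := add_halves ε

theorem exists_seq_isTopologicalBasis [SecondCountableTopology X] :
    ∃ O : ℕ → Set X, TopologicalSpace.IsTopologicalBasis (range O) := by
  obtain ⟨O, hO⟩ := ((TopologicalSpace.countable_countableBasis X).insert ∅).exists_eq_range
    (insert_nonempty _ _)
  exact ⟨O, hO ▸ (TopologicalSpace.isBasis_countableBasis X).insert_empty⟩

end Pattern

section FunctionSpaces

variable {X : Type*}

theorem tendsto_nhds_subtype_iff_forall {Y ι : Type*} [TopologicalSpace Y] {p : (X → Y) → Prop}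
    {l : Filter ι} {g : ι → {f // p f}} {f : {f // p f}} :
    Tendsto g l (𝓝 f) ↔ ∀ x, Tendsto (fun i => (g i).1 x) l (𝓝 (f.1 x)) := by
  rw [tendsto_subtype_rng, tendsto_pi_nhds]

theorem seqDense_iff_forall_exists_tendsto {Y : Type*} [TopologicalSpace Y] {p : (X → Y) → Prop}
    {D : Set {f // p f}} :
    SeqDense D ↔ ∀ f : {f // p f}, ∃ g : ℕ → {f // p f}, (∀ n, g n ∈ D) ∧
      ∀ x, Tendsto (fun n => (g n).1 x) atTop (𝓝 (f.1 x)) := by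
  simp only [← tendsto_nhds_subtype_iff_forall]
  exact eq_univ_iff_forall

theorem seqDense_range_of_eventually_dist_lt {Y : Type*} [PseudoMetricSpace Y]
    {p : (X → Y) → Prop} {d e : ℕ → {f // p f}} (hd : SeqDense (range d))
    (h : ∀ x, ∀ᶠ n : ℕ in atTop,
      dist ((e n).1 x) ((d n.unpair.1).1 x) < 1 / ((n : ℝ) + 1)) :
    SeqDense (range e) := by
  rw [seqDense_iff_forall_exists_tendsto] at hd ⊢
  intro f
  obtain ⟨g, hg, hgf⟩ := hd f
  choose m hm using hg
  have hpair : Tendsto (fun i => Nat.pair (m i) i) atTop atTop :=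
    tendsto_atTop_mono (fun i => Nat.right_le_pair _ _) tendsto_id
  refine ⟨fun i => e (Nat.pair (m i) i), fun i => mem_range_self _, fun x => ?_⟩
  refine (hgf x).congr_dist (squeeze_zero' (Eventually.of_forall fun i => dist_nonneg) ?_
    ((tendsto_one_div_add_atTop_nhds_zero_nat (𝕜 := ℝ)).comp hpair))
  filter_upwards [hpair.eventually (h x)] with i hi
  rw [Nat.unpair_pair, hm i, dist_comm] at hi
  exact hi.le

variable {p : (X → ℝ) → Prop}

theorem seqSeparable_of_forall_isFσ_preimage [TopologicalSpace X] [HasOuterApproxClosed X]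
    [SecondCountableTopology X] (hp : ∀ f, IsBaireOne f → p f)
    (hFσ : ∀ f, p f → ∀ U, IsOpen U → IsFσ (f ⁻¹' U)) : SeqSeparable {f // p f} := by
  obtain ⟨O, hO⟩ := exists_seq_isTopologicalBasis (X := X)
  have hopen : ∀ i, IsOpen (O i) := fun i => hO.isOpen (mem_range_self i)
  let d : (Σ n, (Fin n → Bool) → ℚ) → {f // p f} := fun a =>
    ⟨fun x => a.2 (pattern (fun i : Fin a.1 => O i) x),
      hp _ (isBaireOne_comp_pattern (O := fun i : Fin a.1 => O i) (fun i => hopen i)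
        fun b => (a.2 b : ℝ))⟩
  refine ⟨range d, countable_range d, seqDense_iff_forall_exists_tendsto.2 fun f => ?_⟩
  obtain ⟨G, hG⟩ := exists_tendsto_comp_pattern hO (hFσ f.1 f.2)
  exact ⟨fun n => d ⟨n, G n⟩, fun n => mem_range_self _, hG⟩

-- Row `n` approximates the member `n.unpair.1` of one dense sequence, so every member of that
-- sequence is approximated in infinitely many rows.
theorem SelectsGammaSeq.s₁_countableSeqDense [MeasurableSpace X]
    (h : SelectsGammaSeq {s : Set X | MeasurableSet s}) [Nonempty {f // p f}]
    (hp : ∀ f, p f → Measurable f) :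
    S₁ (CountableSeqDense {f // p f}) (CountableSeqDense {f // p f}) := by
  intro A hA
  have hdense := fun n => seqDense_iff_forall_exists_tendsto.1 (hA n).2
  have hne : (A 0).Nonempty := by
    obtain ⟨g, hg, -⟩ := hdense 0 (Classical.arbitrary _)
    exact ⟨g 0, hg 0⟩
  obtain ⟨d, hd⟩ := (hA 0).1.exists_eq_range hne
  choose e heA helim using fun n => hdense n (d n.unpair.1)
  obtain ⟨k, hk⟩ := h
    (fun n k => {x | dist ((e n k).1 x) ((d n.unpair.1).1 x) < 1 / ((n : ℝ) + 1)})
    (fun n k => measurableSet_lt ((hp _ (e n k).2).dist (hp _ (d _).2)) measurable_const)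
    (fun n x => Metric.tendsto_nhds.1 (helim n x) _ Nat.one_div_pos_of_nat)
  exact ⟨fun n => e n (k n), fun n => heA n _, countable_range _,
    seqDense_range_of_eventually_dist_lt (hd ▸ (hA 0).2) hk⟩

/-- The members of the function space `{f // p f}` obtained by replacing a function from `D` by `0`
outside one of the sets `V k`. -/
def truncations (D : Set {f // p f}) (V : ℕ → Set X) : Set {f // p f} :=
  {g | ∃ k, ∃ f ∈ D, g.1 = (V k).indicator f.1}

theorem truncations_mem_countableSeqDense {D : Set {f // p f}}
    (hD : D ∈ CountableSeqDense {f // p f}) {V : ℕ → Set X} (hV : IsGammaSeq V)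
    (hind : ∀ f, p f → ∀ k, p ((V k).indicator f)) :
    truncations D V ∈ CountableSeqDense {f // p f} := by
  let cut : ℕ → {f // p f} → {f // p f} := fun k f => ⟨(V k).indicator f.1, hind _ f.2 k⟩
  refine ⟨(countable_iUnion fun k => hD.1.image (cut k)).mono ?_,
    seqDense_iff_forall_exists_tendsto.2 fun f => ?_⟩
  · rintro g ⟨k, f, hf, hg⟩
    exact mem_iUnion.2 ⟨k, f, hf, Subtype.ext hg.symm⟩
  · obtain ⟨g, hg, hgf⟩ := seqDense_iff_forall_exists_tendsto.1 hD.2 f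
    refine ⟨fun k => cut k (g k), fun k => ⟨k, g k, hg k, rfl⟩, fun x => ?_⟩
    refine (hgf x).congr' ?_
    filter_upwards [hV x] with k hk
    exact (indicator_of_mem hk _).symm

theorem exists_ne_zero_const_notMem [Nonempty X] (hconst : ∀ c : ℝ, p fun _ => c)
    {A : Set {f // p f}} (hA : A.Countable) :
    ∃ c : ℝ, c ≠ 0 ∧ (⟨fun _ => c, hconst c⟩ : {f // p f}) ∉ A := by
  let const : ℝ → {f // p f} := fun c => ⟨fun _ => c, hconst c⟩
  have hinj : Function.Injective const := fun a b hab =>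
    congrFun (Subtype.ext_iff.1 hab) (Classical.arbitrary X)
  have hdense : Dense (const ⁻¹' A)ᶜ := (hA.preimage_of_injOn hinj.injOn).dense_compl ℝ
  obtain ⟨c, hcA, hc⟩ := hdense.exists_mem_open isOpen_ne ⟨1, one_ne_zero⟩
  exact ⟨c, hc, hcA⟩

-- The target constant `c` avoids all rows, so a sequence of selected functions converging to it
-- visits each row finitely often; and a truncation is nonzero only on the set it is cut to.
theorem SelectsGammaSeq.of_sFin_countableSeqDense {𝒞 : Set (Set X)} (h𝒞 : FiniteInter 𝒞)
    (hconst : ∀ c : ℝ, p fun _ => c) (hind : ∀ f, p f → ∀ s ∈ 𝒞, p (s.indicator f))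
    (hsep : SeqSeparable {f // p f})
    (h : SFin (CountableSeqDense {f // p f}) (CountableSeqDense {f // p f})) :
    SelectsGammaSeq 𝒞 := by
  rcases isEmpty_or_nonempty X with hX | hX
  · exact fun W _ _ => ⟨fun _ => 0, fun x => isEmptyElim x⟩
  refine selectsGammaSeq_of_antitone h𝒞 fun V hV hγ hanti => ?_
  obtain ⟨D, hD⟩ := hsep
  have hA : ∀ n, truncations D (V n) ∈ CountableSeqDense {f // p f} := fun n =>
    truncations_mem_countableSeqDense hD (hγ n) fun f hf k => hind f hf _ (hV n k)
  obtain ⟨B, hB, -, hBdense⟩ := h _ hA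
  obtain ⟨c, hc, hcA⟩ := exists_ne_zero_const_notMem hconst (countable_iUnion fun n => (hA n).1)
  obtain ⟨b, hb, hbc⟩ : ⟨fun _ => c, hconst c⟩ ∈ seqClosure (⋃ n, B n) := hBdense ▸ mem_univ _
  choose ν hν using fun i => mem_iUnion.1 (hb i)
  choose κ f _ hf using fun i => (hB (ν i)).2 (hν i)
  have hνtop : Tendsto ν atTop atTop :=
    tendsto_atTop_of_mem_finite (fun n => (hB n).1) hν fun n g hg =>
      hbc.eventually_ne (ne_of_mem_of_not_mem (mem_iUnion_of_mem n ((hB n).2 hg)) hcA).symm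
  refine exists_isGammaSeq_of_tendsto hanti hνtop (κ := κ) fun x => ?_
  filter_upwards [(tendsto_nhds_subtype_iff_forall.1 hbc x).eventually_ne hc] with i hi
  exact mem_of_indicator_ne_zero (hf i ▸ hi)

end FunctionSpaces

end BorelSelection

open BorelSelection in
theorem theorem1_general (X : Type*) [TopologicalSpace X]
    [TopologicalSpace.PseudoMetrizableSpace X] [SecondCountableTopology X] [MeasurableSpace X]
    [BorelSpace X] :
    List.TFAE [
      S₁ (CountableSeqDense (BorelFun X))
          (CountableSeqDense (BorelFun X)) ∧
        SeqSeparable (BorelFun X),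
      S₁ (BorelGamma X) (BorelGamma X),
      SFin (CountableSeqDense (BorelFun X))
          (CountableSeqDense (BorelFun X)) ∧
        SeqSeparable (BorelFun X),
      SFin (BorelGamma X) (BorelGamma X),
      S₁ (CountableSeqDense (BaireOneFun X))
        (CountableSeqDense (BaireOneFun X)),
      S₁ (ClosedGamma X) (ClosedGamma X),
      SFin (CountableSeqDense (BaireOneFun X))
        (CountableSeqDense (BaireOneFun X))] := by
  have of_closed := SelectsGammaSeq.of_sFin (finiteInter_isClosed (X := X))
  have borel_iff := selectsGammaSeq_measurableSet_iff_isClosed (X := X)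
  have : Nonempty (BorelFun X) := ⟨⟨fun _ => 0, measurable_const⟩⟩
  have : Nonempty (BaireOneFun X) := ⟨⟨fun _ => 0, isBaireOne_const 0⟩⟩
  have baireOne_separable : SeqSeparable (BaireOneFun X) :=
    seqSeparable_of_forall_isFσ_preimage (fun _ hf => hf) fun _ hf _ hU =>
      IsBaireOne.isFσ_preimage hf hU
  tfae_have 1 → 3 := fun h => ⟨h.1.sFin, h.2⟩
  tfae_have 2 → 4 := S₁.sFin
  tfae_have 5 → 7 := S₁.sFin
  tfae_have 4 → 6 := fun h =>
    (borel_iff.1 (.of_sFin finiteInter_measurableSet h)).s₁ finiteInter_isClosed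
  tfae_have 6 → 2 := fun h => (borel_iff.2 (of_closed h.sFin)).s₁ finiteInter_measurableSet
  tfae_have 6 → 1 := fun h =>
    ⟨(borel_iff.2 (of_closed h.sFin)).s₁_countableSeqDense fun _ hf => hf,
      seqSeparable_of_forall_isFσ_preimage (fun _ hf => hf.measurable) fun _ hf _ hU =>
        (of_closed h.sFin).isFσ_of_measurableSet (hf hU.measurableSet)⟩
  tfae_have 6 → 5 := fun h =>
    (borel_iff.2 (of_closed h.sFin)).s₁_countableSeqDense fun _ => IsBaireOne.measurable
  tfae_have 3 → 6 := fun h =>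
    (SelectsGammaSeq.of_sFin_countableSeqDense finiteInter_isClosed (fun _ => measurable_const)
      (fun _ hf _ hs => hf.indicator (IsClosed.measurableSet hs)) h.2 h.1).s₁ finiteInter_isClosed
  tfae_have 7 → 6 := fun h =>
    (SelectsGammaSeq.of_sFin_countableSeqDense finiteInter_isClosed isBaireOne_const
      (fun _ hf _ hs => IsBaireOne.indicator hf hs) baireOne_separable h).s₁ finiteInter_isClosed
  tfae_finish

theorem theorem1 (X : Set ℝ) :
    List.TFAE [
      BorelSelection.S₁ (BorelSelection.CountableSeqDense (BorelSelection.BorelFun X))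
          (BorelSelection.CountableSeqDense (BorelSelection.BorelFun X)) ∧
        BorelSelection.SeqSeparable (BorelSelection.BorelFun X),
      BorelSelection.S₁ (BorelSelection.BorelGamma X) (BorelSelection.BorelGamma X),
      BorelSelection.SFin (BorelSelection.CountableSeqDense (BorelSelection.BorelFun X))
          (BorelSelection.CountableSeqDense (BorelSelection.BorelFun X)) ∧
        BorelSelection.SeqSeparable (BorelSelection.BorelFun X),
      BorelSelection.SFin (BorelSelection.BorelGamma X) (BorelSelection.BorelGamma X),
      BorelSelection.S₁ (BorelSelection.CountableSeqDense (BorelSelection.BaireOneFun X))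
        (BorelSelection.CountableSeqDense (BorelSelection.BaireOneFun X)),
      BorelSelection.S₁ (BorelSelection.ClosedGamma X) (BorelSelection.ClosedGamma X),
      BorelSelection.SFin (BorelSelection.CountableSeqDense (BorelSelection.BaireOneFun X))
        (BorelSelection.CountableSeqDense (BorelSelection.BaireOneFun X))] :=
  theorem1_general X
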